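/- Let $\mathbb{R}^\infty$ be the set of all finite tuples of real numbers; a real number is identified with the corresponding tuple of length one. An oracle BSS machine with oracle $A\subseteq\mathbb{R}^\infty$ is given by a finite program with finitely many real parameters. It works on a tape whose cells are blank or hold a real number, and it can write parameters, copy and delete the contents of cells, shift the tape, test whether a cell is blank, perform the four field operations exactly, fork according to whether the content of a cell is $<0$, $=0$ or $>0$, and fork according to whether a finite tuple standing on its tape belongs to $A$. A set $S\subseteq\mathbb{R}^\infty$ is BSS-semidecidable below $A$ if it is the domain of some partial function $\mathbb{R}^\infty\rightharpoonup\mathbb{R}^\infty$ computed by an oracle BSS machine with oracle $A$. Let $C\subseteq[0,1]$ be the Cantor middle-thirds set and let $\mathbb{A}\subseteq\mathbb{R}$ be the set of real numbers algebraic over $\mathbb{Q}$. Then $C$ is not BSS-semidecidable below $\mathbb{A}$, and for every oracle $A\subseteq\mathbb{R}^\infty$ of cardinality $|A|<2^{\aleph_0}$, $C$ is not BSS-semidecidable below $A$. -/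

import Mathlib

namespace BSS

/-- The four field operations on real numbers. -/
inductive FieldOp where
  | add
  | sub
  | mul
  | div

/-- Evaluation of a field operation. Division by zero is undefined. -/
noncomputable def FieldOp.eval : FieldOp → ℝ → ℝ → Option ℝ
  | .add, x, y => some (x + y)
  | .sub, x, y => some (x - y)
  | .mul, x, y => some (x * y)
  | .div, x, y => if y = 0 then none else some (x / y)

/-- Instructions of an oracle BSS machine. The cells of the tape are numbered by integers, relative
to a head that a shift moves by one cell; `ℕ`-valued arguments of the last three instructions are
line numbers of the program to jump to. All other instructions continue at the next line.
* `const k r`: write the real parameter `r` into cell `k`;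
* `copy i k`: copy the content of cell `i` into cell `k`;
* `erase k`: delete the content of cell `k` (the cell becomes blank);
* `arith op i j k`: apply `op` to the contents of cells `i` and `j`, write the result to cell `k`;
* `shiftLeft`, `shiftRight`: shift the whole tape by one cell;
* `fork i a b c`: jump to `a`, `b`, `c` if the number in cell `i` is `< 0`, `= 0`, `> 0`;
* `ifBlank i a b`: jump to `a` if cell `i` is blank, and to `b` otherwise;
* `query i a b`: jump to `a` if the tuple standing on the tape from cell `i` up to the next blank
  cell belongs to the oracle, and to `b` otherwise;
* `halt`: stop. -/
inductive Instr where
  | const (k : ℤ) (r : ℝ)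
  | copy (i k : ℤ)
  | erase (k : ℤ)
  | arith (op : FieldOp) (i j k : ℤ)
  | shiftLeft
  | shiftRight
  | halt
  | fork (i : ℤ) (a b c : ℕ)
  | ifBlank (i : ℤ) (a b : ℕ)
  | query (i : ℤ) (a b : ℕ)

/-- A program is a finite list of instructions (hence has only finitely many real parameters). -/
abbrev Program := List Instr

/-- A tape: each cell holds a real number or is blank (`none`). -/
abbrev Tape := ℤ → Option ℝ

/-- The tuple `y` stands on the tape from cell `i` up to the next blank cell. -/
def Reads (T : Tape) (i : ℤ) (y : List ℝ) : Prop :=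
  ∀ n : ℕ, n ≤ y.length → T (i + n) = y[n]?

/-- A configuration: the current program line and the content of the tape. -/
structure Config where
  pc : ℕ
  tape : Tape

/-- The initial configuration on input `x`: the tuple `x` stands in the cells `0, 1, …`,
and all other cells are blank. -/
def initial (x : List ℝ) : Config where
  pc := 0
  tape := fun n => if 0 ≤ n then x[n.toNat]? else none

open Classical in
/-- One step of the program `P` with oracle `A`. There is no next configuration if the machine has
halted, if the program line does not exist, or if the instruction cannot be carried out (a field
operation or a sign test on a blank cell, or a division by zero). -/
noncomputable def step (P : Program) (A : Set (List ℝ)) (c : Config) : Option Config :=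
  match P[c.pc]? with
  | none => none
  | some (.const k r) => some ⟨c.pc + 1, Function.update c.tape k (some r)⟩
  | some (.copy i k) => some ⟨c.pc + 1, Function.update c.tape k (c.tape i)⟩
  | some (.erase k) => some ⟨c.pc + 1, Function.update c.tape k none⟩
  | some (.arith op i j k) =>
      (c.tape i).bind fun x => (c.tape j).bind fun y => (op.eval x y).map fun z =>
        ⟨c.pc + 1, Function.update c.tape k (some z)⟩
  | some .shiftLeft => some ⟨c.pc + 1, fun n => c.tape (n + 1)⟩
  | some .shiftRight => some ⟨c.pc + 1, fun n => c.tape (n - 1)⟩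
  | some .halt => none
  | some (.fork i a b d) =>
      (c.tape i).map fun x => ⟨if x < 0 then a else if x = 0 then b else d, c.tape⟩
  | some (.ifBlank i a b) => some ⟨if c.tape i = none then a else b, c.tape⟩
  | some (.query i a b) => some ⟨if ∃ y ∈ A, Reads c.tape i y then a else b, c.tape⟩

/-- The configuration at stage `t` of the run of `P` with oracle `A` on input `x`, if any. -/
noncomputable def configAt (P : Program) (A : Set (List ℝ)) (x : List ℝ) : ℕ → Option Config
  | 0 => some (initial x)
  | t + 1 => (configAt P A x t).bind (step P A)

/-- With oracle `A` and input `x`, the program `P` halts after finitely many steps with output `y`,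
the tuple that then stands on the tape from cell `0` up to the next blank cell. -/
def HaltsWith (P : Program) (A : Set (List ℝ)) (x y : List ℝ) : Prop :=
  ∃ (t : ℕ) (c : Config),
    configAt P A x t = some c ∧ P[c.pc]? = some .halt ∧ Reads c.tape 0 y

/-- A partial function from tuples to tuples is BSS-computable in the oracle `A`. -/
def ComputableIn (A : Set (List ℝ)) (f : List ℝ →. List ℝ) : Prop :=
  ∃ P : Program, ∀ x y : List ℝ, y ∈ f x ↔ HaltsWith P A x y

/-- A set of tuples is BSS-semidecidable below the oracle `A` if it is the domain of a partial
function that is BSS-computable in `A`. -/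
def SemidecidableIn (A S : Set (List ℝ)) : Prop :=
  ∃ f : List ℝ →. List ℝ, ComputableIn A f ∧ f.Dom = S

/-- A set of real numbers, viewed as a set of tuples of length one. -/
def asTuples (S : Set ℝ) : Set (List ℝ) := (fun x : ℝ => [x]) '' S

/-- The set of real algebraic numbers. -/
def algebraicReals : Set ℝ := {x : ℝ | IsAlgebraic ℚ x}

end BSS

open Cardinal Topology Filter

namespace BSS

/-! Let `K` be the field generated by the program's parameters and the entries of the oracle; it has
fewer than `𝔠` elements. On an input `x` transcendental over `K`, every nonblank cell holds `f(x)`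
for some `f` in `K(X)`. If `f(x) = r` with `r` in `K`, then `f` is the constant `r`, so oracle
answers do not depend on `x`; signs of nonzero `f` are locally constant by continuity. Hence halting
is an open condition on transcendental inputs (`eventually_haltsWith`). By cardinality, the Cantor
set contains a transcendental `x₀`. A machine halting there also halts on all nearby transcendental
inputs. Some of these lie outside the Cantor set, which is closed with empty interior. -/

/-- The real numbers that are transcendental over the subfield `K`. -/
abbrev TranscendentalReals (K : Subfield ℝ) : Type := {x : ℝ // Transcendental K x}

/-- Evaluation of rational functions over `K` at a number transcendental over `K`. -/
noncomputable def ratEval {K : Subfield ℝ} (x : TranscendentalReals K) : RatFunc K →+* ℝ :=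
  IsFractionRing.lift (A := Polynomial K) (g := (Polynomial.aeval x.1).toRingHom)
    (transcendental_iff_injective.1 x.2)

variable {K : Subfield ℝ}

theorem ratEval_algebraMap (x : TranscendentalReals K) (p : Polynomial K) :
    ratEval x (algebraMap (Polynomial K) (RatFunc K) p) = Polynomial.aeval x.1 p :=
  IsFractionRing.lift_algebraMap _ p

theorem ratEval_C (x : TranscendentalReals K) (r : K) : ratEval x (RatFunc.C r) = r := by
  rw [← RatFunc.algebraMap_C, ratEval_algebraMap, Polynomial.aeval_C]
  rfl

theorem ratEval_X (x : TranscendentalReals K) : ratEval x RatFunc.X = x := by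
  rw [← RatFunc.algebraMap_X, ratEval_algebraMap, Polynomial.aeval_X]

/-- Restricting to transcendental points removes all poles: a nonzero denominator over `K` cannot
vanish there. -/
theorem continuous_ratEval (f : RatFunc K) :
    Continuous fun x : TranscendentalReals K => ratEval x f := by
  have h : ∀ x : TranscendentalReals K,
      ratEval x f = Polynomial.aeval x.1 f.num / Polynomial.aeval x.1 f.denom := fun x => by
    rw [← ratEval_algebraMap, ← ratEval_algebraMap, ← map_div₀, RatFunc.num_div_denom]
  simp_rw [h]
  refine Continuous.div ?_ ?_ fun x => ?_
  · exact (Polynomial.continuous_aeval _).comp continuous_subtype_val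
  · exact (Polynomial.continuous_aeval _).comp continuous_subtype_val
  · rw [← ratEval_algebraMap, Ne, map_eq_zero]
    exact RatFunc.algebraMap_ne_zero f.denom_ne_zero

/-! ### Symbolic execution over `K(X)` -/

/-- The tape obtained from a tape of rational functions by evaluating each cell at `x`. -/
noncomputable def realize (s : ℤ → Option (RatFunc K)) (x : TranscendentalReals K) : Tape :=
  fun n => (s n).map (ratEval x)

theorem realize_update (s : ℤ → Option (RatFunc K)) (x : TranscendentalReals K) (k : ℤ)
    (v : Option (RatFunc K)) :
    realize (Function.update s k v) x =
      Function.update (realize s x) k (v.map (ratEval x)) := by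
  funext n
  by_cases h : n = k
  · subst h; simp [realize]
  · simp [realize, h]

theorem realize_eq_none_iff {s : ℤ → Option (RatFunc K)} {x : TranscendentalReals K} {i : ℤ} :
    realize s x i = none ↔ s i = none := by
  simp [realize]

/-- Evaluation at `x` is injective on `K(X)`. The point is that the right-hand side does not mention
`x`. -/
theorem reads_realize_iff {s : ℤ → Option (RatFunc K)} {y : List ℝ} (hy : ∀ r ∈ y, r ∈ K)
    (x : TranscendentalReals K) (i : ℤ) :
    Reads (realize s x) i y ↔
      ∀ n ≤ y.length, s (i + n) = y.attach[n]?.map fun r => RatFunc.C ⟨r.1, hy r.1 r.2⟩ := by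
  refine forall₂_congr fun n _ => ?_
  have h : y[n]? = (y.attach[n]?.map fun r => RatFunc.C ⟨r.1, hy r.1 r.2⟩).map (ratEval x) := by
    rw [Option.map_map]
    conv_lhs => rw [← List.attach_map_subtype_val y, List.getElem?_map]
    congr 1
    funext r
    exact (ratEval_C x ⟨r.1, hy r.1 r.2⟩).symm
  rw [h]
  exact (Option.map_injective (ratEval x).injective).eq_iff

/-- The parameters of an instruction. -/
def Instr.params : Instr → Set ℝ
  | .const _ r => {r}
  | _ => ∅

theorem exists_ratEval_eq_fieldOp_eval (op : FieldOp) {f g : RatFunc K}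
    {x₀ : TranscendentalReals K} {z : ℝ} (h : op.eval (ratEval x₀ f) (ratEval x₀ g) = some z) :
    ∃ q : RatFunc K, ∀ x, op.eval (ratEval x f) (ratEval x g) = some (ratEval x q) := by
  cases op with
  | add => exact ⟨f + g, fun x => by simp [FieldOp.eval]⟩
  | sub => exact ⟨f - g, fun x => by simp [FieldOp.eval]⟩
  | mul => exact ⟨f * g, fun x => by simp [FieldOp.eval]⟩
  | div =>
    -- A divisor that is nonzero at `x₀` is nonzero in `K(X)`, hence at every transcendental `x`.
    have hg : g ≠ 0 := by
      rintro rfl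
      simp [FieldOp.eval] at h
    exact ⟨f / g, fun x => by simp [FieldOp.eval, hg]⟩

/-- This is the only kind of instruction for which the neighbourhood of `x₀` has to shrink. -/
theorem eventually_sign_test_eq {α : Type*} (f : RatFunc K) (x₀ : TranscendentalReals K)
    (a b d : α) :
    ∀ᶠ x in 𝓝 x₀, (if ratEval x f < 0 then a else if ratEval x f = 0 then b else d) =
      if ratEval x₀ f < 0 then a else if ratEval x₀ f = 0 then b else d := by
  rcases lt_trichotomy (ratEval x₀ f) 0 with h | h | h
  · filter_upwards [(continuous_ratEval f).continuousAt.eventually_lt continuousAt_const h] with x hx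
    rw [if_pos hx, if_pos h]
  · obtain rfl : f = 0 := by simpa using h
    simp
  · filter_upwards [continuousAt_const.eventually_lt (continuous_ratEval f).continuousAt h] with x hx
    rw [if_neg hx.not_gt, if_neg hx.ne', if_neg h.not_gt, if_neg h.ne']

theorem eventually_step_realize {P : Program} {A : Set (List ℝ)}
    (hP : ∀ I ∈ P, I.params ⊆ K) (hA : ∀ y ∈ A, ∀ r ∈ y, r ∈ K)
    (pc : ℕ) (s : ℤ → Option (RatFunc K)) (x₀ : TranscendentalReals K) {c : Config}
    (hc : step P A ⟨pc, realize s x₀⟩ = some c) :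
    ∃ (pc' : ℕ) (s' : ℤ → Option (RatFunc K)),
      ∀ᶠ x in 𝓝 x₀, step P A ⟨pc, realize s x⟩ = some ⟨pc', realize s' x⟩ := by
  cases hI : P[pc]? with
  | none => simp [step, hI] at hc
  | some I =>
    have hmem : I ∈ P := List.mem_of_getElem? hI
    simp only [step, hI] at hc ⊢
    cases I with
    | halt => simp at hc
    | const k r =>
      have hr : r ∈ K := hP _ hmem rfl
      exact ⟨pc + 1, Function.update s k (some (RatFunc.C ⟨r, hr⟩)), .of_forall fun x => by
        simp [realize_update, ratEval_C]⟩
    | copy i k =>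
      exact ⟨pc + 1, Function.update s k (s i), .of_forall fun x => by
        simp [realize_update, realize]⟩
    | erase k =>
      exact ⟨pc + 1, Function.update s k none, .of_forall fun x => by simp [realize_update]⟩
    | shiftLeft => exact ⟨pc + 1, fun n => s (n + 1), .of_forall fun x => rfl⟩
    | shiftRight => exact ⟨pc + 1, fun n => s (n - 1), .of_forall fun x => rfl⟩
    | arith op i j k =>
      cases hi : s i with
      | none => simp [realize, hi] at hc
      | some f =>
        cases hj : s j with
        | none => simp [realize, hi, hj] at hc
        | some g =>
          simp only [realize, hi, hj, Option.map_some, Option.bind_some, Option.map_eq_some_iff]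
            at hc
          obtain ⟨z, hz, -⟩ := hc
          obtain ⟨q, hq⟩ := exists_ratEval_eq_fieldOp_eval op hz
          refine ⟨pc + 1, Function.update s k (some q), .of_forall fun x => ?_⟩
          rw [realize_update]
          simp [realize, hi, hj, hq]
    | fork i a b d =>
      cases hi : s i with
      | none => simp [realize, hi] at hc
      | some f =>
        refine ⟨if ratEval x₀ f < 0 then a else if ratEval x₀ f = 0 then b else d, s,
          (eventually_sign_test_eq f x₀ a b d).mono fun x hx => ?_⟩
        rw [← hx]
        simp [realize, hi]
    | ifBlank i a b =>
      exact ⟨if s i = none then a else b, s, .of_forall fun x => by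
        simp only [realize_eq_none_iff]⟩
    | query i a b =>
      classical
      refine ⟨if ∃ y ∈ A, Reads (realize s x₀) i y then a else b, s, .of_forall fun x => ?_⟩
      have h : (∃ y ∈ A, Reads (realize s x) i y) ↔ ∃ y ∈ A, Reads (realize s x₀) i y :=
        exists_congr fun y => and_congr_right fun hy => by
          rw [reads_realize_iff (hA y hy), reads_realize_iff (hA y hy)]
      simp only [h]

theorem initial_eq_realize (x : TranscendentalReals K) :
    initial [x.1] = ⟨0, realize (fun n => if n = 0 then some RatFunc.X else none) x⟩ := by
  simp only [initial, Config.mk.injEq, true_and]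
  funext n
  by_cases h : n = 0
  · subst h; simp [realize, ratEval_X]
  · simp only [realize, h, if_false, Option.map_none]
    split_ifs with h0
    · rw [List.getElem?_eq_none]
      simp only [List.length_singleton]
      omega
    · rfl

theorem eventually_configAt_realize {P : Program} {A : Set (List ℝ)}
    (hP : ∀ I ∈ P, I.params ⊆ K) (hA : ∀ y ∈ A, ∀ r ∈ y, r ∈ K)
    (x₀ : TranscendentalReals K) (t : ℕ) {c : Config} (hc : configAt P A [x₀.1] t = some c) :
    ∃ (pc : ℕ) (s : ℤ → Option (RatFunc K)),
      ∀ᶠ x in 𝓝 x₀, configAt P A [x.1] t = some ⟨pc, realize s x⟩ := by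
  induction t generalizing c with
  | zero => exact ⟨0, _, .of_forall fun x => congrArg some (initial_eq_realize x)⟩
  | succ t ih =>
    obtain ⟨c₁, h₁, h₂⟩ := Option.bind_eq_some_iff.1 hc
    obtain ⟨pc, s, hs⟩ := ih h₁
    rw [hs.self_of_nhds, Option.some.injEq] at h₁
    subst h₁
    obtain ⟨pc', s', hs'⟩ := eventually_step_realize hP hA pc s x₀ h₂
    refine ⟨pc', s', ?_⟩
    filter_upwards [hs, hs'] with x hx hx'
    simp [configAt, hx, hx']

/-- If a machine whose parameters and whose oracle lie in `K` halts on an input that is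
transcendental over `K`, then it halts on all nearby such inputs. -/
theorem eventually_haltsWith {P : Program} {A : Set (List ℝ)}
    (hP : ∀ I ∈ P, I.params ⊆ K) (hA : ∀ y ∈ A, ∀ r ∈ y, r ∈ K)
    (x₀ : TranscendentalReals K) {y₀ : List ℝ} (h : HaltsWith P A [x₀.1] y₀) :
    ∀ᶠ x in 𝓝 x₀, ∃ y, HaltsWith P A [x.1] y := by
  obtain ⟨t, c, hc, hhalt, hread⟩ := h
  obtain ⟨pc, s, hs⟩ := eventually_configAt_realize hP hA x₀ t hc
  rw [hs.self_of_nhds, Option.some.injEq] at hc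
  subst hc
  filter_upwards [hs] with x hx
  -- Blankness does not depend on `x`, so the output keeps the length of `y₀`, and the default `0`
  -- is never used.
  refine ⟨y₀.mapIdx fun n _ => ((realize s x (0 + n)).getD 0), t, _, hx, hhalt, fun n hn => ?_⟩
  rw [List.length_mapIdx] at hn
  have hn' : realize s x₀ (0 + n) = y₀[n]? := hread n hn
  rw [List.getElem?_mapIdx]
  cases hv : y₀[n]? with
  | none =>
    rw [hv] at hn'
    simp only [Option.map_none]
    exact realize_eq_none_iff.2 (realize_eq_none_iff.1 hn')
  | some v =>
    rw [hv] at hn'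
    have hne : s (0 + (n : ℤ)) ≠ none := fun h0 => by
      rw [realize_eq_none_iff.2 h0] at hn'
      cases hn'
    obtain ⟨f, hf⟩ := Option.ne_none_iff_exists'.1 hne
    simp only [Option.map_some, realize, hf, Option.getD_some]

/-! ### Cardinality and the topology of the Cantor set -/

theorem exists_mem_transcendental {K : Subfield ℝ} (hK : #K < 𝔠) {S : Set ℝ} (hS : 𝔠 ≤ #S) :
    ∃ x ∈ S, Transcendental K x := by
  by_contra! h
  have hsub : S ⊆ {x | IsAlgebraic K x} := fun x hx => not_not.1 (h x hx)
  have h₁ : #S ≤ max #K ℵ₀ := (mk_le_mk_of_subset hsub).trans (Algebraic.cardinalMk_le_max K ℝ)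
  exact (hS.trans h₁).not_gt (max_lt hK aleph0_lt_continuum)

theorem continuum_le_mk_cantorSet : 𝔠 ≤ #cantorSet := by
  rw [cantorSetEquivNatToBool.cardinal_eq]
  simp

theorem interior_cantorSet : interior cantorSet = ∅ := by
  have : TotallyDisconnectedSpace cantorSet :=
    cantorSetHomeomorphNatToBool.symm.totallyDisconnectedSpace
  have htd : IsTotallyDisconnected cantorSet := totallyDisconnectedSpace_subtype_iff.1 this
  rw [Set.eq_empty_iff_forall_notMem]
  intro x hx
  obtain ⟨ε, hε, hball⟩ := Metric.mem_nhds_iff.1 (mem_interior_iff_mem_nhds.1 hx)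
  -- A ball is connected, so inside a totally disconnected set it would have only one point.
  have h := htd _ hball (convex_ball x ε).isPreconnected (Metric.mem_ball_self hε)
    (show x + ε / 2 ∈ Metric.ball x ε by
      rw [Metric.mem_ball, Real.dist_eq, add_sub_cancel_left, abs_of_pos (by positivity)]
      linarith)
  linarith

/-- The field generated by the parameters of a program and the entries of an oracle. -/
noncomputable def coefficientField (P : Program) (A : Set (List ℝ)) : Subfield ℝ :=
  Subfield.closure ((⋃ I ∈ {I | I ∈ P}, I.params) ∪ ⋃ y ∈ A, {r | r ∈ y})

theorem mk_coefficientField_lt (P : Program) {A : Set (List ℝ)} (hA : #A < 𝔠) :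
    #(coefficientField P A) < 𝔠 := by
  refine (Subfield.cardinalMk_closure_le_max _).trans_lt (max_lt ?_ aleph0_lt_continuum)
  refine (mk_union_le _ _).trans_lt (add_lt_of_lt aleph0_le_continuum ?_ ?_)
  · refine lt_of_le_of_lt ?_ aleph0_lt_continuum
    refine le_aleph0_iff_set_countable.2 ((List.finite_toSet P).countable.biUnion fun I _ => ?_)
    cases I <;> simp [Instr.params]
  · refine (mk_biUnion_le _ _).trans_lt (mul_lt_of_lt aleph0_le_continuum hA ?_)
    refine lt_of_le_of_lt (ciSup_le' fun y => ?_) aleph0_lt_continuum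
    exact le_aleph0_iff_set_countable.2 (List.finite_toSet y.1).countable

theorem params_subset_coefficientField {P : Program} (A : Set (List ℝ)) {I : Instr} (hI : I ∈ P) :
    I.params ⊆ coefficientField P A := fun _ hr =>
  Subfield.subset_closure (Or.inl (Set.mem_biUnion (show I ∈ {I | I ∈ P} from hI) hr))

theorem mem_coefficientField_of_mem (P : Program) {A : Set (List ℝ)} {y : List ℝ} (hy : y ∈ A)
    {r : ℝ} (hr : r ∈ y) : r ∈ coefficientField P A :=
  Subfield.subset_closure (Or.inr (Set.mem_biUnion hy hr))

theorem not_semidecidableIn_cantorSet {A : Set (List ℝ)} (hA : #A < 𝔠) :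
    ¬ SemidecidableIn A (asTuples cantorSet) := by
  rintro ⟨f, ⟨P, hP⟩, hdom⟩
  have hiff : ∀ x : ℝ, x ∈ cantorSet ↔ ∃ y, HaltsWith P A [x] y := fun x => by
    have h : [x] ∈ f.Dom ↔ ∃ y, HaltsWith P A [x] y := by
      simp only [PFun.mem_dom, hP]
    rw [← h, hdom]
    simp [asTuples]
  have hK := mk_coefficientField_lt P hA
  obtain ⟨x₀, hx₀, htr⟩ := exists_mem_transcendental hK continuum_le_mk_cantorSet
  obtain ⟨y, hy⟩ := (hiff x₀).1 hx₀
  have hev := eventually_haltsWith (K := coefficientField P A)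
    (fun I hI => params_subset_coefficientField A hI)
    (fun y hy r hr => mem_coefficientField_of_mem P hy hr) ⟨x₀, htr⟩ hy
  obtain ⟨U, hU, hUsub⟩ := mem_nhds_subtype _ _ _ |>.1 hev
  obtain ⟨V, hVU, hVo, hxV⟩ := mem_nhds_iff.1 hU
  have hne : (V ∩ cantorSetᶜ).Nonempty := by
    by_contra hemp
    have hsub : V ⊆ cantorSet := fun z hz => by
      by_contra hzC
      exact hemp ⟨z, hz, hzC⟩
    have : x₀ ∈ interior cantorSet := interior_maximal hsub hVo hxV
    rw [interior_cantorSet] at this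
    exact this
  -- Halting is known only at transcendental points of `V`; a nonempty open set has at least `𝔠`
  -- points, so one of them is transcendental.
  obtain ⟨x, ⟨hxV', hxC⟩, hx⟩ := exists_mem_transcendental hK
    (continuum_le_cardinal_of_isOpen ℝ (hVo.inter isClosed_cantorSet.isOpen_compl) hne)
  exact hxC ((hiff x).2 (hUsub (show (⟨x, hx⟩ : TranscendentalReals _) ∈ _ from hVU hxV')))

theorem mk_asTuples_algebraicReals_lt : #(asTuples algebraicReals) < 𝔠 := by
  have hc : algebraicReals.Countable := Algebraic.countable ℚ ℝ
  exact (le_aleph0_iff_set_countable.2 (hc.image _)).trans_lt aleph0_lt_continuum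

end BSS

theorem mainTheorem5 :
    ¬ BSS.SemidecidableIn (BSS.asTuples BSS.algebraicReals) (BSS.asTuples cantorSet) ∧
      ∀ A : Set (List ℝ), Cardinal.mk A < 2 ^ Cardinal.aleph0 →
        ¬ BSS.SemidecidableIn A (BSS.asTuples cantorSet) :=
  ⟨BSS.not_semidecidableIn_cantorSet BSS.mk_asTuples_algebraicReals_lt,
    fun _ hA => BSS.not_semidecidableIn_cantorSet (by rwa [two_power_aleph0] at hA)⟩
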